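/- Let $E$ and $F$ be complex Banach spaces and let $U\subseteq E$ be open. For a complex Banach space $G$ let $\mathcal{H}^\infty(U,G)$ be the space of bounded holomorphic mappings $U\to G$ with the supremum norm, and $\mathcal{H}^\infty(U)=\mathcal{H}^\infty(U,\mathbb{C})$. For $x\in U$ let $\delta(x)\in\mathcal{H}^\infty(U)^*$ be evaluation at $x$; let $\Delta(U)$ be the linear span of $\{\delta(x):x\in U\}$ and $\mathcal{G}^\infty(U)$ its norm closure in $\mathcal{H}^\infty(U)^*$. Each $u=\sum_i\gamma_i\otimes y_i\in\mathcal{G}^\infty(U)\otimes F$ acts linearly on $f\in\mathcal{H}^\infty(U,F^*)$ by $u(f)=\sum_i\gamma_i(\langle f(\cdot),y_i\rangle)$; in particular $(\delta(x)\otimes y)(f)=\langle f(x),y\rangle$. Put $$H(u)=\sup\{|u(f)|: f\in\mathcal{H}^\infty(U,F^*),\ \|f\|_\infty\le 1\}.$$ Then: 1. If $u(f)=0$ for all $f\in\mathcal{H}^\infty(U,F^*)$, then $u=0$; so $H$ is a norm on $\mathcal{G}^\infty(U)\otimes F$. 2. $H$ coincides on $\mathcal{G}^\infty(U)\otimes F$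 with the projective norm $\pi(u)=\inf\sum_{i=1}^n\|\gamma_i\|\,\|y_i\|$ and with the Chevet--Saphar norm $g_1(u)=\inf\big(\sum_{i=1}^n\|\gamma_i\|\big)\sup_{\|\phi\|_{F^*}\le1}\max_{i}|\phi(y_i)|$, the infima being over all representations $u=\sum_{i=1}^n\gamma_i\otimes y_i$ with $\gamma_i\in\mathcal{G}^\infty(U)$, $y_i\in F$. Likewise, on $\Delta(U)\otimes F$ the norm $H$ coincides with the norms $\pi$ and $g_1$ of $\Delta(U)\otimes F$ (the same infima, over representations with all $\gamma_i\in\Delta(U)$). 3. Let $\mathcal{G}^\infty(U)\widehat\otimes_H F$ be the completion of $\mathcal{G}^\infty(U)\otimes F$ for the norm $H$. There is an isometric linear isomorphism $\Lambda$ of $\mathcal{H}^\infty(U,F^*)$ onto $(\mathcal{G}^\infty(U)\widehat\otimes_H F)^*$ such that $$\Lambda(f)\Big(\sum_{i=1}^n\lambda_i\,\delta(x_i)\otimes y_i\Big)=\sum_{i=1}^n\lambda_i\langle f(x_i),y_i\rangle\qquad(\lambda_i\in\mathbb{C},\ x_i\in U,\ y_i\in F),$$ $\Lambda(f)$ is the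 only continuous linear functional with this property, and the inverse is given by $\langle\Lambda^{-1}(\varphi)(x),y\rangle=\varphi(\delta(x)\otimes y)$ for $\varphi\in(\mathcal{G}^\infty(U)\widehat\otimes_H F)^*$, $x\in U$, $y\in F$. -/

import Mathlib

open TensorProduct
open scoped ENNReal

noncomputable section

namespace HolDual

section Spaces

variable {E : Type*} [NormedAddCommGroup E] [NormedSpace ℂ E]

/-- The bounded continuous mappings `U → F` that are holomorphic, that is, restrictions to the
open set `U` of mappings that are complex Fréchet differentiable at every point of `U`. -/
def holSubmodule (U : TopologicalSpace.Opens E) (F : Type*) [NormedAddCommGroup F]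
    [NormedSpace ℂ F] : Submodule ℂ (BoundedContinuousFunction U F) where
  carrier := {f | ∃ g : E → F, DifferentiableOn ℂ g (U : Set E) ∧ ∀ x : U, g x = f x}
  add_mem' := by
    rintro f₁ f₂ ⟨g₁, h₁, e₁⟩ ⟨g₂, h₂, e₂⟩
    exact ⟨g₁ + g₂, h₁.add h₂, fun x => by simp [e₁, e₂]⟩
  zero_mem' := ⟨0, differentiableOn_const 0, fun x => by simp⟩
  smul_mem' := by
    rintro c f ⟨g, h, e⟩
    exact ⟨c • g, h.const_smul c, fun x => by simp [e]⟩

variable (U : TopologicalSpace.Opens E) (F : Type*) [NormedAddCommGroup F] [NormedSpace ℂ F]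

/-- Membership in `holSubmodule U F` is possession of a differential at each point of `U`. -/
theorem mem_holSubmodule_iff (f : BoundedContinuousFunction U F) :
    f ∈ holSubmodule U F ↔ ∀ a : U, ∃ T : E →L[ℂ] F,
      (fun x : U => f x - f a - T ((x : E) - a)) =o[nhds a] fun x : U => (x : E) - a := by
  have key : ∀ (g : E → F), (∀ x : U, g x = f x) → ∀ (a : U) (T : E →L[ℂ] F),
      (HasFDerivAt g T (a : E) ↔
        (fun x : U => f x - f a - T ((x : E) - a)) =o[nhds a] fun x : U => (x : E) - a) := by
    intro g hg a T
    rw [hasFDerivAt_iff_isLittleO, ← U.isOpenEmbedding'.map_nhds_eq a,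
      Asymptotics.isLittleO_map]
    simp [Function.comp_def, hg]
  constructor
  · rintro ⟨g, h, e⟩ a
    exact ⟨_, (key g e a _).1 ((h a a.2).differentiableAt (U.isOpen.mem_nhds a.2)).hasFDerivAt⟩
  · intro h
    classical
    let g : E → F := fun z => if hz : z ∈ U then f ⟨z, hz⟩ else 0
    have e : ∀ x : U, g x = f x := by
      intro x; simp [g]
    refine ⟨g, fun a ha => ?_, e⟩
    obtain ⟨T, hT⟩ := h ⟨a, ha⟩
    exact ((key g e ⟨a, ha⟩ T).2 hT).differentiableAt.differentiableWithinAt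

/-- `HInf U F` is the space of bounded holomorphic mappings `f : U → F`, with the supremum norm
(see `HInf.norm_eq_iSup`). -/
def HInf : Type _ := holSubmodule U F

instance : NormedAddCommGroup (HInf U F) := inferInstanceAs (NormedAddCommGroup (holSubmodule U F))

instance : NormedSpace ℂ (HInf U F) := inferInstanceAs (NormedSpace ℂ (holSubmodule U F))

instance : CoeFun (HInf U F) (fun _ => U → F) := ⟨fun f => f.1⟩

variable {U F} in
@[ext] theorem HInf.ext {f g : HInf U F} (h : ∀ x, f x = g x) : f = g :=
  Subtype.ext (BoundedContinuousFunction.ext h)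

theorem HInf.norm_eq_iSup (f : HInf U F) : ‖f‖ = ⨆ x : U, ‖f x‖ :=
  BoundedContinuousFunction.norm_eq_iSup_norm f.1

/-- The inclusion of `HInf U F` in the bounded continuous mappings. -/
def HInf.toBCF : HInf U F →L[ℂ] BoundedContinuousFunction U F := (holSubmodule U F).subtypeL

/-- The evaluation functional `δ(x) : f ↦ f(x)` on `HInf U ℂ`. -/
def evalFun (x : U) : StrongDual ℂ (HInf U ℂ) :=
  (BoundedContinuousFunction.evalCLM ℂ x).comp (HInf.toBCF U ℂ)

@[simp] theorem evalFun_apply (x : U) (f : HInf U ℂ) : evalFun U x f = f x := rfl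

/-- The linear span of the evaluation functionals, as a subspace of `(HInf U ℂ)*`. -/
def deltaSubmodule : Submodule ℂ (StrongDual ℂ (HInf U ℂ)) :=
  Submodule.span ℂ (Set.range (evalFun U))

/-- The norm-closed linear hull of the evaluation functionals in `(HInf U ℂ)*`. -/
def gSubmodule : Submodule ℂ (StrongDual ℂ (HInf U ℂ)) := (deltaSubmodule U).topologicalClosure

theorem deltaSubmodule_le_gSubmodule : deltaSubmodule U ≤ gSubmodule U :=
  Submodule.le_topologicalClosure _

/-- The space `Δ(U)`, with the norm of `(HInf U ℂ)*`. -/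
def Delta : Type _ := deltaSubmodule U

instance : NormedAddCommGroup (Delta U) := inferInstanceAs (NormedAddCommGroup (deltaSubmodule U))

instance : NormedSpace ℂ (Delta U) := inferInstanceAs (NormedSpace ℂ (deltaSubmodule U))

/-- The space `G^∞(U)`, with the norm of `(HInf U ℂ)*`. -/
def GInf : Type _ := gSubmodule U

instance : NormedAddCommGroup (GInf U) := inferInstanceAs (NormedAddCommGroup (gSubmodule U))

instance : NormedSpace ℂ (GInf U) := inferInstanceAs (NormedSpace ℂ (gSubmodule U))

/-- The inclusion of `G^∞(U)` in `(HInf U ℂ)*`. -/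
def GInf.toDual : GInf U →ₗᵢ[ℂ] StrongDual ℂ (HInf U ℂ) := (gSubmodule U).subtypeₗᵢ

/-- The inclusion of `Δ(U)` in `G^∞(U)`. -/
def Delta.toGInf : Delta U →ₗ[ℂ] GInf U :=
  Submodule.inclusion (deltaSubmodule_le_gSubmodule U)

/-- `δ(x)` as an element of `G^∞(U)`. -/
def delta (x : U) : GInf U :=
  ⟨evalFun U x, deltaSubmodule_le_gSubmodule U (Submodule.subset_span ⟨x, rfl⟩)⟩

/-- For `y : F`, the map sending `f : U → F*` to the scalar function `x ↦ ⟨f(x), y⟩`. -/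
def slice (y : F) : HInf U (StrongDual ℂ F) →L[ℂ] HInf U ℂ :=
  (((ContinuousLinearMap.apply ℂ ℂ y).compLeftContinuousBounded U).comp
    (HInf.toBCF U (StrongDual ℂ F))).codRestrict (holSubmodule U ℂ) (by
      rintro ⟨f, g, hg, e⟩
      exact ⟨fun z => g z y,
        (ContinuousLinearMap.apply ℂ ℂ y).differentiable.comp_differentiableOn hg,
        fun x => by simp only [e]; rfl⟩)

@[simp] theorem slice_apply (y : F) (f : HInf U (StrongDual ℂ F)) (x : U) :
    slice U F y f x = f x y := rfl

/-- The linear map that regards a tensor in `GInf U ⊗ F` as a functional on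
`HInf U F*`: `(γ ⊗ y)(f) = γ (x ↦ ⟨f(x), y⟩)`. -/
def pairing : GInf U ⊗[ℂ] F →ₗ[ℂ] StrongDual ℂ (HInf U (StrongDual ℂ F)) :=
  TensorProduct.lift <| LinearMap.mk₂ ℂ
    (fun (γ : GInf U) (y : F) => (GInf.toDual U γ).comp (slice U F y))
    (fun _ _ _ => rfl) (fun _ _ _ => rfl)
    (fun γ y₁ y₂ => by
      ext f
      have : slice U F (y₁ + y₂) f = slice U F y₁ f + slice U F y₂ f := by
        ext x; exact map_add (f x) y₁ y₂
      simp [this])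
    (fun c γ y => by
      ext f
      have : slice U F (c • y) f = c • slice U F y f := by
        ext x; exact map_smul (f x) c y
      simp [this])

@[simp] theorem pairing_tmul (γ : GInf U) (y : F) (f : HInf U (StrongDual ℂ F)) :
    pairing U F (γ ⊗ₜ y) f = GInf.toDual U γ (slice U F y f) := rfl

/-- On `δ(x) ⊗ y` the functional is `f ↦ ⟨f(x), y⟩`. -/
theorem pairing_delta_tmul (x : U) (y : F) (f : HInf U (StrongDual ℂ F)) :
    pairing U F (delta U x ⊗ₜ y) f = f x y := rfl

/-- The norm `H` on `GInf U ⊗ F`, dual to the supremum norm of `HInf U F*`. -/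
def normH (u : GInf U ⊗[ℂ] F) : ℝ :=
  sSup {r : ℝ | ∃ f : HInf U (StrongDual ℂ F), ‖f‖ ≤ 1 ∧ r = ‖pairing U F u f‖}

theorem normH_eq_norm_pairing (u : GInf U ⊗[ℂ] F) : normH U F u = ‖pairing U F u‖ := by
  rw [← (pairing U F u).sSup_unitClosedBall_eq_norm, normH]
  congr 1
  ext r
  simp [eq_comm]

/-- A type synonym for `GInf U ⊗ F`, to be equipped with the norm `H`. -/
def GTensorH : Type _ := GInf U ⊗[ℂ] F

instance : AddCommGroup (GTensorH U F) :=
  inferInstanceAs (AddCommGroup (GInf U ⊗[ℂ] F))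

instance : Module ℂ (GTensorH U F) := inferInstanceAs (Module ℂ (GInf U ⊗[ℂ] F))

/-- The identity map from `GInf U ⊗ F` to the copy that carries the norm `H`. -/
def toH : GInf U ⊗[ℂ] F ≃ₗ[ℂ] GTensorH U F := LinearEquiv.refl ℂ _

instance : SeminormedAddCommGroup (GTensorH U F) :=
  SeminormedAddCommGroup.induced (GTensorH U F) (StrongDual ℂ (HInf U (StrongDual ℂ F)))
    ((pairing U F).comp (toH U F).symm.toLinearMap)

instance : NormedSpace ℂ (GTensorH U F) :=
  NormedSpace.induced ℂ (GTensorH U F) (StrongDual ℂ (HInf U (StrongDual ℂ F)))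
    ((pairing U F).comp (toH U F).symm.toLinearMap)

theorem norm_toH (u : GInf U ⊗[ℂ] F) : ‖toH U F u‖ = normH U F u :=
  (normH_eq_norm_pairing U F u).symm

/-- The completion of `GInf U ⊗ F` with respect to the norm `H`. -/
abbrev CompletedTensorH : Type _ := UniformSpace.Completion (GTensorH U F)

/-- The canonical map from `GInf U ⊗ F` to its completion. -/
def inclH (u : GInf U ⊗[ℂ] F) : CompletedTensorH U F := (toH U F u : CompletedTensorH U F)

/-- The canonical map `Delta U ⊗ F → GInf U ⊗ F`. -/
def deltaIncl : Delta U ⊗[ℂ] F →ₗ[ℂ] GInf U ⊗[ℂ] F :=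
  TensorProduct.map (Delta.toGInf U) LinearMap.id

end Spaces

section TensorNorms

variable {X Y : Type*} [NormedAddCommGroup X] [NormedSpace ℂ X]
  [NormedAddCommGroup Y] [NormedSpace ℂ Y]

/-- The projective norm on `X ⊗ Y`. -/
def projNorm (u : X ⊗[ℂ] Y) : ℝ :=
  sInf {r : ℝ | ∃ (n : ℕ) (x : Fin n → X) (y : Fin n → Y),
    u = ∑ i, x i ⊗ₜ[ℂ] y i ∧ r = ∑ i, ‖x i‖ * ‖y i‖}

/-- The strong norm of `(x₁, …, xₙ)` in `ℓ_p^n(X)`. -/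
def strongNorm (p : ℝ≥0∞) {n : ℕ} (x : Fin n → X) : ℝ := ‖WithLp.toLp p x‖

/-- The weak norm of `(y₁, …, yₙ)` in `ℓ_p^{n,w}(Y)`. -/
def weakNorm (p : ℝ≥0∞) {n : ℕ} (y : Fin n → Y) : ℝ :=
  sSup {r : ℝ | ∃ φ : StrongDual ℂ Y, ‖φ‖ ≤ 1 ∧ r = strongNorm p fun i => φ (y i)}

/-- The Chevet–Saphar norm `g_p` on `X ⊗ Y`. -/
def chevetSaphar (p : ℝ≥0∞) (u : X ⊗[ℂ] Y) : ℝ :=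
  sInf {r : ℝ | ∃ (n : ℕ) (x : Fin n → X) (y : Fin n → Y),
    u = ∑ i, x i ⊗ₜ[ℂ] y i ∧ r = strongNorm p x * weakNorm (ENNReal.conjExponent p) y}

end TensorNorms

end HolDual

end

noncomputable section

namespace HolDual

/-! ### The projective norm and its norming operators -/

section ProjectiveNorm

variable {X Y : Type*} [NormedAddCommGroup X] [NormedSpace ℂ X]
  [NormedAddCommGroup Y] [NormedSpace ℂ Y]

/-! The map `δ : U → G^∞(U)` is holomorphic and bounded by 1, so every operator `T : G^∞(U) → F*`
yields the bounded holomorphic map `T ∘ δ`, of norm at most `‖T‖`. Since the `δ(x)` span a dense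
subspace, `(γ ⊗ y)(T ∘ δ) = T γ y` for all `γ` (`toDual_slice_ofClm`).

The triangle inequality gives `H ≤ π`. Conversely, Hahn–Banach supplies a functional attaining
`π(u)`, which is an operator `T` into `F*` with `‖T‖ ≤ 1` (`exists_norming_clm`); then `T ∘ δ` is a
competitor in the supremum defining `H`, and its value at `u` is `π(u)`. Rescaling the factors gives
`g_1 = π`.

For the duality, a functional on the completion curries to an operator `T` and hence to `T ∘ δ`;
conversely `f` acts on tensors with bound `H(u)‖f‖`, so its action extends to the completion. Both
constructions are norm-decreasing and mutually inverse. -/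

theorem exists_fin_sum_tmul (u : X ⊗[ℂ] Y) :
    ∃ (n : ℕ) (x : Fin n → X) (y : Fin n → Y), u = ∑ i, x i ⊗ₜ[ℂ] y i := by
  induction u with
  | zero => exact ⟨0, 0, 0, by simp⟩
  | tmul x y => exact ⟨1, fun _ => x, fun _ => y, by simp⟩
  | add u v hu hv =>
    obtain ⟨n, x, y, rfl⟩ := hu
    obtain ⟨m, x', y', rfl⟩ := hv
    exact ⟨n + m, Fin.append x x', Fin.append y y', by simp [Fin.sum_univ_add]⟩

theorem projNorm_le_sum {n : ℕ} (x : Fin n → X) (y : Fin n → Y) :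
    projNorm (∑ i, x i ⊗ₜ[ℂ] y i) ≤ ∑ i, ‖x i‖ * ‖y i‖ := by
  refine csInf_le ⟨0, ?_⟩ ⟨n, x, y, rfl, rfl⟩
  rintro r ⟨n, x, y, -, rfl⟩
  positivity

theorem le_projNorm {u : X ⊗[ℂ] Y} {a : ℝ}
    (h : ∀ (n : ℕ) (x : Fin n → X) (y : Fin n → Y),
      u = ∑ i, x i ⊗ₜ[ℂ] y i → a ≤ ∑ i, ‖x i‖ * ‖y i‖) : a ≤ projNorm u := by
  obtain ⟨n, x, y, hu⟩ := exists_fin_sum_tmul u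
  refine le_csInf ⟨_, n, x, y, hu, rfl⟩ ?_
  rintro r ⟨m, x', y', h', rfl⟩
  exact h m x' y' h'

theorem projNorm_nonneg (u : X ⊗[ℂ] Y) : 0 ≤ projNorm u :=
  le_projNorm fun _ _ _ _ => by positivity

theorem projNorm_tmul_le (x : X) (y : Y) : projNorm (x ⊗ₜ[ℂ] y) ≤ ‖x‖ * ‖y‖ := by
  simpa using projNorm_le_sum (fun _ : Fin 1 => x) (fun _ => y)

theorem projNorm_add_le (u v : X ⊗[ℂ] Y) : projNorm (u + v) ≤ projNorm u + projNorm v := by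
  rw [← sub_le_iff_le_add]
  refine le_projNorm fun n x y hu => ?_
  rw [sub_le_iff_le_add, ← sub_le_iff_le_add']
  refine le_projNorm fun m x' y' hv => ?_
  have := projNorm_le_sum (Fin.append x x') (Fin.append y y')
  simp only [Fin.sum_univ_add, Fin.append_left, Fin.append_right, ← hu, ← hv] at this
  linarith

theorem projNorm_smul_le (c : ℂ) (u : X ⊗[ℂ] Y) : projNorm (c • u) ≤ ‖c‖ * projNorm u := by
  rcases eq_or_ne c 0 with rfl | hc
  · simpa using projNorm_tmul_le (0 : X) (0 : Y)
  · rw [← div_le_iff₀' (norm_pos_iff.2 hc)]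
    refine le_projNorm fun n x y hu => ?_
    rw [div_le_iff₀' (norm_pos_iff.2 hc)]
    have := projNorm_le_sum (fun i => c • x i) y
    simpa [← TensorProduct.smul_tmul', ← Finset.smul_sum, ← hu, norm_smul, mul_assoc,
      ← Finset.mul_sum] using this

/-- The projective norm as a seminorm. -/
def projSeminorm (X Y : Type*) [NormedAddCommGroup X] [NormedSpace ℂ X]
    [NormedAddCommGroup Y] [NormedSpace ℂ Y] : Seminorm ℂ (X ⊗[ℂ] Y) :=
  Seminorm.ofSMulLE projNorm
    (le_antisymm (by simpa using projNorm_tmul_le (0 : X) (0 : Y)) (projNorm_nonneg _))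
    projNorm_add_le projNorm_smul_le

/-- A norming bilinear form for the projective norm, in curried form. -/
theorem exists_norming_clm (u : X ⊗[ℂ] Y) :
    ∃ (φ : X ⊗[ℂ] Y →ₗ[ℂ] ℂ) (T : X →L[ℂ] StrongDual ℂ Y), ‖T‖ ≤ 1 ∧
      (∀ x y, T x y = φ (x ⊗ₜ y)) ∧ φ u = projNorm u := by
  obtain ⟨φ, hφ, hu⟩ : ∃ φ : X ⊗[ℂ] Y →ₗ[ℂ] ℂ,
      (∀ v, ‖φ v‖ ≤ projNorm v) ∧ φ u = projNorm u := by
    rcases eq_or_ne u 0 with rfl | hu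
    · refine ⟨0, fun v => by simpa using projNorm_nonneg v, ?_⟩
      have : projNorm (0 : X ⊗[ℂ] Y) = 0 := map_zero (projSeminorm X Y)
      simp [this]
    -- Hahn–Banach from the line `ℂu`, where `c u ↦ c π(u)` is dominated by `π`.
    · obtain ⟨g, hg, hle⟩ := Module.Dual.exists_extension_of_le_seminorm (ℂ ∙ u)
        ((projNorm u : ℂ) • (LinearEquiv.coord ℂ _ u hu : _ →ₗ[ℂ] ℂ)) (p := projSeminorm X Y)
        (by
          rintro ⟨v, hv⟩
          obtain ⟨c, rfl⟩ := Submodule.mem_span_singleton.1 hv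
          have : LinearEquiv.coord ℂ _ u hu ⟨c • u, hv⟩ = c := by
            rw [LinearEquiv.coord, LinearEquiv.symm_apply_eq]; rfl
          have h2 : projSeminorm X Y u = projNorm u := rfl
          simp [this, map_smul_eq_mul, h2, abs_of_nonneg (projNorm_nonneg u), mul_comm])
      refine ⟨g, hle, ?_⟩
      have := hg ⟨u, Submodule.mem_span_singleton_self u⟩
      simpa [LinearEquiv.coord_self] using this
  refine ⟨φ, LinearMap.mkContinuous₂ (TensorProduct.curry φ) 1 fun x y => ?_,
    LinearMap.mkContinuous₂_norm_le _ zero_le_one _, fun x y => rfl, hu⟩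
  rw [one_mul]
  exact (hφ _).trans (projNorm_tmul_le x y)

end ProjectiveNorm

/-! ### The Chevet–Saphar norm for `p = 1` -/

section ChevetSaphar

theorem strongNorm_one {X : Type*} [NormedAddCommGroup X] {n : ℕ} (x : Fin n → X) :
    strongNorm 1 x = ∑ i, ‖x i‖ :=
  PiLp.norm_eq_of_L1 _

theorem strongNorm_top {X : Type*} [NormedAddCommGroup X] {n : ℕ} (x : Fin n → X) :
    strongNorm ∞ x = ‖x‖ :=
  PiLp.norm_toLp x

variable {X Y : Type*} [NormedAddCommGroup X] [NormedSpace ℂ X]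
  [NormedAddCommGroup Y] [NormedSpace ℂ Y]

/-- The supremum over `φ` and the maximum over `i` commute, and each `y i` has a norming functional.
-/
theorem weakNorm_top {n : ℕ} (y : Fin n → Y) : weakNorm ∞ y = ‖y‖ := by
  have hle : ∀ r ∈ {r : ℝ | ∃ φ : StrongDual ℂ Y, ‖φ‖ ≤ 1 ∧ r = strongNorm ∞ fun i => φ (y i)},
      r ≤ ‖y‖ := by
    rintro r ⟨φ, hφ, rfl⟩
    rw [strongNorm_top]
    refine (pi_norm_le_iff_of_nonneg (norm_nonneg _)).2 fun i => ?_
    exact (φ.le_of_opNorm_le hφ _).trans (by simpa using norm_le_pi_norm y i)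
  refine le_antisymm (csSup_le ⟨_, 0, by simp, rfl⟩ hle) ?_
  refine (pi_norm_le_iff_of_nonneg ?_).2 fun i => ?_
  · exact le_csSup_of_le ⟨_, hle⟩ ⟨0, by simp, rfl⟩ (norm_nonneg _)
  · obtain ⟨φ, hφ, h⟩ := exists_dual_vector'' ℂ (y i)
    refine le_csSup_of_le ⟨_, hle⟩ ⟨φ, hφ, rfl⟩ ?_
    rw [strongNorm_top]
    simpa [h] using norm_le_pi_norm (fun i => φ (y i)) i

/-- Moving the scalar `‖y i‖` onto `x i` turns a projective sum into a Chevet–Saphar product with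
second factor at most 1; the other inequality is `‖y i‖ ≤ max ‖y j‖`. -/
theorem chevetSaphar_one_eq_projNorm (u : X ⊗[ℂ] Y) : chevetSaphar 1 u = projNorm u := by
  have hc : ENNReal.conjExponent 1 = ∞ := by simp [ENNReal.conjExponent]
  simp only [chevetSaphar, hc, strongNorm_one, weakNorm_top]
  apply le_antisymm
  · refine le_projNorm fun n x y hu => ?_
    have hs : ∀ i, ((‖y i‖ : ℂ) • x i) ⊗ₜ[ℂ] ((‖y i‖⁻¹ : ℂ) • y i) = x i ⊗ₜ y i := by
      intro i
      rcases eq_or_ne (y i) 0 with h | h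
      · simp [h]
      · rw [TensorProduct.smul_tmul, smul_smul, mul_inv_cancel₀ (by simpa using h), one_smul]
    refine csInf_le_of_le ⟨0, ?_⟩
      ⟨n, fun i => (‖y i‖ : ℂ) • x i, fun i => (‖y i‖⁻¹ : ℂ) • y i, by simp only [hs, hu], rfl⟩ ?_
    · rintro r ⟨n, x, y, -, rfl⟩
      positivity
    · have h1 : ‖fun i => (‖y i‖⁻¹ : ℂ) • y i‖ ≤ 1 := by
        refine (pi_norm_le_iff_of_nonneg zero_le_one).2 fun i => ?_
        simpa [norm_smul] using inv_mul_le_one (a := ‖y i‖)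
      refine (mul_le_of_le_one_right (by positivity) h1).trans_eq ?_
      simp [norm_smul, mul_comm]
  · obtain ⟨n, x, y, hu⟩ := exists_fin_sum_tmul u
    refine le_csInf ⟨_, n, x, y, hu, rfl⟩ ?_
    rintro r ⟨n, x, y, rfl, rfl⟩
    refine (projNorm_le_sum x y).trans ?_
    rw [Finset.sum_mul]
    gcongr with i
    exact norm_le_pi_norm y i

end ChevetSaphar

/-! ### Holomorphy of `δ` into the dual of `H^∞(U)` -/

section Holomorphy

open Metric

/-- Second order Taylor estimate for a bounded holomorphic mapping on a ball. -/
theorem norm_sub_sub_fderiv_le {E F : Type*} [NormedAddCommGroup E] [NormedSpace ℂ E]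
    [NormedAddCommGroup F] [NormedSpace ℂ F] {g : E → F} {a z : E} {r C : ℝ} (hr : 0 < r)
    (hg : DifferentiableOn ℂ g (ball a r)) (hC : ∀ w ∈ ball a r, ‖g w‖ ≤ C) (hz : z ∈ ball a r) :
    ‖fderiv ℂ g a‖ ≤ 2 * C / r ∧
      ‖g z - g a - fderiv ℂ g a (z - a)‖ ≤ 4 * C * (‖z - a‖ / r) ^ 2 := by
  have ha : a ∈ ball a r := mem_ball_self hr
  have hsub : ∀ w ∈ ball a r, ‖g w - g a‖ ≤ 2 * C := fun w hw => by
    linarith [norm_sub_le (g w) (g a), hC w hw, hC a ha]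
  have hd : ‖fderiv ℂ g a‖ ≤ 2 * C / r :=
    Complex.norm_fderiv_le_div_of_mapsTo_ball hg
      (fun w hw => by simpa [dist_eq_norm] using hsub w hw) hr
  refine ⟨hd, ?_⟩
  set h : E → F := fun w => g w - g a - fderiv ℂ g a (w - a) with hh
  have h0 : h a = 0 := by simp [hh]
  -- Higher-order Schwarz lemma: `h` is `o(w - a)`, which gives the exponent `n + 1 = 2`. The bound
  -- `4C` is `2C` for the increment of `g` plus `2C` for its linear part.
  have key := Complex.dist_le_mul_div_pow_of_mapsTo_ball_of_isLittleO (f := h) (c := a) (n := 1)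
    (R₁ := r) (R₂ := 4 * C) (z := z) ?_ ?_ ?_ hz
  · rw [dist_eq_norm, dist_eq_norm, h0, sub_zero] at key
    exact key
  · exact (hg.sub_const _).sub
      ((fderiv ℂ g a).differentiable.comp (differentiable_id.sub_const a)).differentiableOn
  · intro w hw
    have h1 : ‖fderiv ℂ g a (w - a)‖ ≤ 2 * C := by
      refine ((fderiv ℂ g a).le_of_opNorm_le hd _).trans ?_
      have h2 : ‖w - a‖ ≤ r := by simpa [dist_eq_norm] using (mem_ball.1 hw).le
      have : 0 ≤ C := (norm_nonneg _).trans (hC a ha)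
      calc 2 * C / r * ‖w - a‖ ≤ 2 * C / r * r := by gcongr
        _ = 2 * C := by field_simp
    rw [mem_closedBall, h0, dist_zero_right]
    linarith [norm_sub_le (g w - g a) (fderiv ℂ g a (w - a)), hsub w hw]
  · have := (hg.differentiableAt (isOpen_ball.mem_nhds ha)).hasFDerivAt
    simpa [h0, hh] using (hasFDerivAt_iff_isLittleO.1 this).norm_right

variable {E : Type*} [NormedAddCommGroup E] [NormedSpace ℂ E] (U : TopologicalSpace.Opens E)

/-- The extension by zero of a bounded holomorphic function. -/
def extendZero : HInf U ℂ →ₗ[ℂ] E → ℂ where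
  toFun f := Function.extend Subtype.val (fun x : U => f x) 0
  map_add' f g := by
    rw [← Function.extend_add, add_zero]; rfl
  map_smul' c f := by
    rw [RingHom.id_apply, ← Function.extend_smul, smul_zero]; rfl

@[simp] theorem extendZero_coe (f : HInf U ℂ) (x : U) : extendZero U f x = f x :=
  Subtype.val_injective.extend_apply _ _ x

theorem differentiableOn_extendZero (f : HInf U ℂ) :
    DifferentiableOn ℂ (extendZero U f) (U : Set E) := by
  obtain ⟨g, hg, e⟩ := f.2
  exact hg.congr fun x hx => (extendZero_coe U f ⟨x, hx⟩).trans (e ⟨x, hx⟩).symm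

theorem HInf.norm_apply_le {F : Type*} [NormedAddCommGroup F] [NormedSpace ℂ F] (f : HInf U F)
    (x : U) : ‖f x‖ ≤ ‖f‖ :=
  BoundedContinuousFunction.norm_coe_le_norm f.1 x

/-- The evaluation map `x ↦ δ(x)` is holomorphic as a mapping to `(HInf U ℂ)*`. -/
theorem exists_fderiv_evalFun (a : U) : ∃ D : E →L[ℂ] StrongDual ℂ (HInf U ℂ),
    (fun x : U => evalFun U x - evalFun U a - D ((x : E) - a)) =o[nhds a]
      fun x : U => (x : E) - a := by
  obtain ⟨r, hr, hU⟩ := Metric.isOpen_iff.1 U.isOpen a a.2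
  -- With `C = ‖f‖` and `r` independent of `f`, the estimates are uniform over the unit ball of
  -- `H^∞(U)`, hence become operator norm estimates.
  have hf := fun (f : HInf U ℂ) (z : E) (hz : z ∈ ball (a : E) r) =>
    norm_sub_sub_fderiv_le (C := ‖f‖) hr ((differentiableOn_extendZero U f).mono hU)
      (fun w hw => by
        simpa only [← extendZero_coe] using HInf.norm_apply_le U f ⟨w, hU hw⟩) hz
  have hda : ∀ f : HInf U ℂ, DifferentiableAt ℂ (extendZero U f) a := fun f =>
    (differentiableOn_extendZero U f).differentiableAt (U.isOpen.mem_nhds a.2)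
  let D : E →L[ℂ] StrongDual ℂ (HInf U ℂ) := LinearMap.mkContinuous₂
    (LinearMap.mk₂ ℂ (fun (h : E) (f : HInf U ℂ) => fderiv ℂ (extendZero U f) a h)
      (fun _ _ _ => map_add _ _ _) (fun _ _ _ => map_smul _ _ _)
      (fun h f g => by rw [map_add, fderiv_add (hda f) (hda g)]; rfl)
      (fun c h f => by rw [map_smul, fderiv_const_smul (hda f)]; rfl)) (2 / r)
    (fun h f => by
      refine (ContinuousLinearMap.le_of_opNorm_le _ (hf f a (mem_ball_self hr)).1 h).trans_eq ?_
      ring)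
  have hD : ∀ h f, D h f = fderiv ℂ (extendZero U f) a h := fun _ _ => rfl
  refine ⟨D, ?_⟩
  have hball : ∀ᶠ x : U in nhds a, (x : E) ∈ ball (a : E) r :=
    continuous_subtype_val.continuousAt (ball_mem_nhds _ hr)
  have hO : (fun x : U => evalFun U x - evalFun U a - D ((x : E) - a)) =O[nhds a]
      fun x : U => ‖(x : E) - a‖ ^ 2 := by
    refine Asymptotics.IsBigO.of_bound (4 / r ^ 2) ?_
    filter_upwards [hball] with x hx
    refine ContinuousLinearMap.opNorm_le_bound _ (by positivity) fun f => ?_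
    have := (hf f x hx).2
    rw [extendZero_coe, extendZero_coe] at this
    refine this.trans_eq ?_
    simp only [norm_pow, norm_norm]
    ring
  refine hO.trans_isLittleO ?_
  have ht : Filter.Tendsto (fun x : U => (x : E) - a) (nhds a) (nhds 0) := by
    have : Continuous fun x : U => (x : E) - a := by fun_prop
    simpa using this.tendsto a
  exact (Asymptotics.isLittleO_norm_pow_id one_lt_two).comp_tendsto ht

end Holomorphy

/-! ### Linearization of bounded holomorphic maps through `G^∞(U)` -/

section Linearization

variable {E : Type*} [NormedAddCommGroup E] [NormedSpace ℂ E] (U : TopologicalSpace.Opens E)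

/-- The evaluation map `x ↦ δ(x)` is holomorphic as a mapping to `GInf U`. -/
theorem exists_fderiv_delta (a : U) : ∃ D : E →L[ℂ] GInf U,
    (fun x : U => delta U x - delta U a - D ((x : E) - a)) =o[nhds a]
      fun x : U => (x : E) - a := by
  classical
  obtain ⟨D, hD⟩ := exists_fderiv_evalFun U a
  let g : E → StrongDual ℂ (HInf U ℂ) := fun z => if hz : z ∈ U then evalFun U ⟨z, hz⟩ else 0
  have hg : ∀ x : U, g x = evalFun U x := fun x => by simp [g]
  have hmem : ∀ z, g z ∈ gSubmodule U := by
    intro z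
    by_cases hz : z ∈ U
    · simp only [g, hz, dite_true]
      exact (delta U ⟨z, hz⟩).2
    · simp only [g, hz, dite_false, zero_mem]
  have hder : HasFDerivAt g D (a : E) := by
    rw [hasFDerivAt_iff_isLittleO, ← U.isOpenEmbedding'.map_nhds_eq a, Asymptotics.isLittleO_map]
    simpa [Function.comp_def, hg] using hD
  -- `D h` is the limit of the quotients `n (g(a + h/n) - g(a))`, which lie in the closed subspace
  -- for every `n` because `g` is 0 off `U`.
  have hDmem : ∀ h, D h ∈ gSubmodule U := fun h =>
    (Submodule.isClosed_topologicalClosure _).mem_of_tendsto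
      (hder.lim h (c := fun n : ℕ => (n : ℂ)) (l := Filter.atTop)
        (by simpa using tendsto_natCast_atTop_atTop (R := ℝ)))
      (Filter.Eventually.of_forall fun n =>
        Submodule.smul_mem _ _ (Submodule.sub_mem _ (hmem _) (hmem _)))
  exact ⟨D.codRestrict (gSubmodule U) hDmem, Asymptotics.isLittleO_norm_left.1 hD.norm_left⟩

theorem norm_delta_le_one (x : U) : ‖delta U x‖ ≤ 1 :=
  (evalFun U x).opNorm_le_bound zero_le_one fun f => by
    simpa using HInf.norm_apply_le U f x

/-- The bounded holomorphic mapping `x ↦ T (δ(x))`. -/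
def HInf.ofClm {F : Type*} [NormedAddCommGroup F] [NormedSpace ℂ F] (T : GInf U →L[ℂ] F) :
    HInf U F := by
  have hd : ∀ a : U, ∃ D : E →L[ℂ] F,
      (fun x : U => T (delta U x) - T (delta U a) - D ((x : E) - a)) =o[nhds a]
        fun x : U => (x : E) - a := fun a => by
    obtain ⟨D, hD⟩ := exists_fderiv_delta U a
    refine ⟨T.comp D, ?_⟩
    simpa using (T.isBigO_comp _ _).trans_isLittleO hD
  have hc : Continuous fun x : U => T (delta U x) := continuous_iff_continuousAt.2 fun a => by
    obtain ⟨D, hD⟩ := hd a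
    have h0 : Filter.Tendsto (fun x : U => (x : E) - a) (nhds a) (nhds 0) := by
      have : Continuous fun x : U => (x : E) - a := by fun_prop
      simpa using this.tendsto a
    have h1 := hD.isBigO.trans_tendsto h0
    have h2 := (h1.add ((D.continuous.tendsto 0).comp h0)).add_const (T (delta U a))
    simpa [ContinuousAt] using h2
  exact ⟨BoundedContinuousFunction.ofNormedAddCommGroup (fun x => T (delta U x)) hc ‖T‖ fun x => by
    simpa using T.le_opNorm_of_le (norm_delta_le_one U x), (mem_holSubmodule_iff U F _).2 hd⟩

variable {F : Type*} [NormedAddCommGroup F] [NormedSpace ℂ F]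

@[simp] theorem HInf.ofClm_apply (T : GInf U →L[ℂ] F) (x : U) : HInf.ofClm U T x = T (delta U x) :=
  rfl

theorem HInf.norm_le {f : HInf U F} {C : ℝ} (hC : 0 ≤ C) (h : ∀ x, ‖f x‖ ≤ C) : ‖f‖ ≤ C :=
  (BoundedContinuousFunction.norm_le hC).2 h

theorem HInf.norm_ofClm_le (T : GInf U →L[ℂ] F) : ‖HInf.ofClm U T‖ ≤ ‖T‖ :=
  HInf.norm_le U (norm_nonneg _) fun x => by
    simpa using T.le_opNorm_of_le (norm_delta_le_one U x)

theorem denseRange_toGInf : DenseRange (Delta.toGInf U) := by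
  intro γ
  have : Subtype.val '' Set.range (Delta.toGInf U) =
      (deltaSubmodule U : Set (StrongDual ℂ (HInf U ℂ))) := by
    ext z
    constructor
    · rintro ⟨_, ⟨d, rfl⟩, rfl⟩
      exact d.2
    · exact fun hz => ⟨_, ⟨⟨z, hz⟩, rfl⟩, rfl⟩
  exact closure_subtype.2 ((congrArg closure this).ge γ.2)

theorem norm_toGInf (γ : Delta U) : ‖Delta.toGInf U γ‖ = ‖γ‖ := rfl

/-- `δ(x)` as an element of `Δ(U)`. -/
def Delta.mk (x : U) : Delta U := ⟨evalFun U x, Submodule.subset_span ⟨x, rfl⟩⟩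

theorem span_range_mk : Submodule.span ℂ (Set.range (Delta.mk U)) = ⊤ := by
  have hs : Set.range (Delta.mk U) =
      ((↑) : deltaSubmodule U → StrongDual ℂ (HInf U ℂ)) ⁻¹' Set.range (evalFun U) := by
    refine Set.ext fun z => ⟨?_, ?_⟩
    · rintro ⟨x, rfl⟩
      exact ⟨x, rfl⟩
    · rintro ⟨x, hx⟩
      exact ⟨x, Subtype.ext hx⟩
  exact (congrArg (Submodule.span ℂ) hs).trans Submodule.span_span_coe_preimage

/-- Continuous linear maps on `GInf U` that agree on the evaluations are equal. -/
theorem GInf.clm_ext {S T : GInf U →L[ℂ] F} (h : ∀ x, S (delta U x) = T (delta U x)) : S = T := by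
  have hΔ : S.toLinearMap ∘ₗ Delta.toGInf U = T.toLinearMap ∘ₗ Delta.toGInf U :=
    LinearMap.ext_on_range (span_range_mk U) h
  exact DFunLike.coe_injective ((denseRange_toGInf U).equalizer S.continuous T.continuous
    (funext fun γ => LinearMap.congr_fun hΔ γ))

theorem exists_extend_toGInf [CompleteSpace F] (T : Delta U →L[ℂ] F) :
    ∃ T' : GInf U →L[ℂ] F, ‖T'‖ ≤ ‖T‖ ∧ ∀ γ, T' (Delta.toGInf U γ) = T γ :=
  ⟨T.toLinearMap.extendOfNorm (Delta.toGInf U),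
    LinearMap.opNorm_extendOfNorm_le (denseRange_toGInf U) (norm_nonneg T) T.le_opNorm,
    LinearMap.extendOfNorm_eq (denseRange_toGInf U) ⟨_, T.le_opNorm⟩⟩

/-- Both sides are continuous and linear in `γ` and agree at each `δ(x)`. This identifies the
pairing against `T ∘ δ` with the bilinear form of `T`. -/
theorem toDual_slice_ofClm (T : GInf U →L[ℂ] StrongDual ℂ F) (γ : GInf U) (y : F) :
    GInf.toDual U γ (slice U F y (HInf.ofClm U T)) = T γ y := by
  have : (ContinuousLinearMap.apply ℂ ℂ (slice U F y (HInf.ofClm U T))).comp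
      (GInf.toDual U).toContinuousLinearMap = (ContinuousLinearMap.apply ℂ ℂ y).comp T :=
    GInf.clm_ext U fun x => rfl
  exact congr($this γ)

end Linearization

/-! ### The norm `H` equals `π`; injectivity of the pairing -/

section NormH

variable {E : Type*} [NormedAddCommGroup E] [NormedSpace ℂ E] (U : TopologicalSpace.Opens E)
  (F : Type*) [NormedAddCommGroup F] [NormedSpace ℂ F]

theorem norm_slice_le (y : F) (f : HInf U (StrongDual ℂ F)) : ‖slice U F y f‖ ≤ ‖f‖ * ‖y‖ :=
  HInf.norm_le U (by positivity) fun x => by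
    rw [slice_apply]
    exact (f x).le_of_opNorm_le (HInf.norm_apply_le U f x) y

theorem normH_tmul_le (γ : GInf U) (y : F) : normH U F (γ ⊗ₜ y) ≤ ‖γ‖ * ‖y‖ := by
  rw [normH_eq_norm_pairing]
  refine ContinuousLinearMap.opNorm_le_bound _ (by positivity) fun f => ?_
  rw [pairing_tmul]
  refine ((GInf.toDual U γ).le_opNorm_of_le (norm_slice_le U F y f)).trans_eq ?_
  rw [LinearIsometry.norm_map]
  ring

theorem normH_sum_le {n : ℕ} (γ : Fin n → GInf U) (y : Fin n → F) :
    normH U F (∑ i, γ i ⊗ₜ y i) ≤ ∑ i, ‖γ i‖ * ‖y i‖ := by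
  rw [normH_eq_norm_pairing, map_sum]
  refine (norm_sum_le _ _).trans (Finset.sum_le_sum fun i _ => ?_)
  rw [← normH_eq_norm_pairing]
  exact normH_tmul_le U F _ _

theorem normH_le_projNorm (u : GInf U ⊗[ℂ] F) : normH U F u ≤ projNorm u :=
  le_projNorm fun _ γ y hu => hu ▸ normH_sum_le U F γ y

theorem normH_deltaIncl_le_projNorm (u : Delta U ⊗[ℂ] F) :
    normH U F (deltaIncl U F u) ≤ projNorm u :=
  le_projNorm fun n γ y hu => by
    subst hu
    simpa [deltaIncl, norm_toGInf] using normH_sum_le U F (fun i => Delta.toGInf U (γ i)) y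

theorem le_normH {u : GInf U ⊗[ℂ] F} {f : HInf U (StrongDual ℂ F)} (hf : ‖f‖ ≤ 1) :
    ‖pairing U F u f‖ ≤ normH U F u := by
  rw [normH_eq_norm_pairing]
  exact (pairing U F u).unit_le_opNorm f hf

/-- The norming operator lives only on `Δ(U)`; as `F*` is complete, it extends to `G^∞(U)` without
increase of norm, and the extension composed with `δ` tests `H`. -/
theorem normH_deltaIncl_eq_projNorm (u : Delta U ⊗[ℂ] F) :
    normH U F (deltaIncl U F u) = projNorm u := by
  refine le_antisymm (normH_deltaIncl_le_projNorm U F u) ?_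
  obtain ⟨φ, T, hT, hφ, hu⟩ := exists_norming_clm u
  obtain ⟨T', hT', hext⟩ := exists_extend_toGInf U T
  have : ∀ v, pairing U F (deltaIncl U F v) (HInf.ofClm U T') = φ v := by
    intro v
    induction v with
    | zero => simp
    | tmul γ y => simp [deltaIncl, toDual_slice_ofClm, hext, hφ]
    | add v w hv hw => simp [hv, hw]
  have h := le_normH U F (u := deltaIncl U F u)
    ((HInf.norm_ofClm_le U T').trans (hT'.trans hT))
  rwa [this, hu, Complex.norm_real, Real.norm_of_nonneg (projNorm_nonneg u)] at h

theorem normH_eq_projNorm (u : GInf U ⊗[ℂ] F) : normH U F u = projNorm u := by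
  refine le_antisymm (normH_le_projNorm U F u) ?_
  obtain ⟨φ, T, hT, hφ, hu⟩ := exists_norming_clm u
  have : ∀ v, pairing U F v (HInf.ofClm U T) = φ v := by
    intro v
    induction v with
    | zero => simp
    | tmul γ y => simp [toDual_slice_ofClm, hφ]
    | add v w hv hw => simp [hv, hw]
  have h := le_normH U F (u := u) ((HInf.norm_ofClm_le U T).trans hT)
  rwa [this, hu, Complex.norm_real, Real.norm_of_nonneg (projNorm_nonneg u)] at h

/-- Write `u = ∑ γ_i ⊗ b_i` over an algebraic basis of `F`. Testing on `x ↦ g(x) φ` gives `φ(∑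
γ_i(g) b_i) = 0` for all `φ`, so the sum vanishes, and independence forces `γ_i(g) = 0` for every
`g`. -/
theorem pairing_injective : Function.Injective (pairing U F) := by
  classical
  refine (injective_iff_map_eq_zero _).2 fun u hu => ?_
  let b := Module.Basis.ofVectorSpace ℂ F
  set e := TensorProduct.equivFinsuppOfBasisRight (M := GInf U) b with he
  suffices e u = 0 by simpa using this
  have hrank : ∀ (g : HInf U ℂ) (φ : StrongDual ℂ F), ∃ f : HInf U (StrongDual ℂ F),
      ∀ x, f x = g x • φ := fun g φ => by
    obtain ⟨g', hg', h'⟩ := g.2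
    refine ⟨⟨((ContinuousLinearMap.toSpanSingleton ℂ φ).compLeftContinuousBounded U) g.1,
      fun z => g' z • φ, hg'.smul_const φ, fun x => ?_⟩, fun x => rfl⟩
    simp only [h']; rfl
  have hzero : ∀ g : HInf U ℂ, ∑ i ∈ (e u).support, GInf.toDual U (e u i) g • b i = 0 := by
    intro g
    refine SeparatingDual.eq_zero_of_forall_dual_eq_zero (R := ℂ) fun φ => ?_
    obtain ⟨f, hf⟩ := hrank g φ
    have hs : ∀ y, slice U F y f = φ y • g := fun y => HInf.ext fun x => by
      rw [slice_apply, hf]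
      exact mul_comm _ _
    have h1 : pairing U F u f = 0 := by rw [hu]; rfl
    rw [← e.symm_apply_apply u, he, TensorProduct.equivFinsuppOfBasisRight_symm_apply, ← he,
      Finsupp.sum, map_sum, sum_apply] at h1
    simpa [hs, mul_comm] using h1
  ext1 i
  refine (GInf.toDual U).injective ?_
  ext g
  rw [Finsupp.zero_apply, map_zero, zero_apply]
  by_cases hi : i ∈ (e u).support
  · exact linearIndependent_iff'.1 b.linearIndependent _ _ (hzero g) i hi
  · simp [Finsupp.notMem_support_iff.1 hi]

end NormH

/-! ### The dual of the completed tensor product -/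

section Duality

variable {E : Type*} [NormedAddCommGroup E] [NormedSpace ℂ E] (U : TopologicalSpace.Opens E)
  (F : Type*) [NormedAddCommGroup F] [NormedSpace ℂ F]

/-- The inclusion of `GInf U ⊗ F` in its completion as a linear map. -/
def inclHₗ : GInf U ⊗[ℂ] F →ₗ[ℂ] CompletedTensorH U F :=
  (UniformSpace.Completion.toComplL (𝕜 := ℂ) (E := GTensorH U F)).toLinearMap ∘ₗ
    (toH U F).toLinearMap

@[simp] theorem inclHₗ_apply (u : GInf U ⊗[ℂ] F) : inclHₗ U F u = inclH U F u := rfl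

theorem norm_inclH (u : GInf U ⊗[ℂ] F) : ‖inclH U F u‖ = normH U F u :=
  (UniformSpace.Completion.norm_coe _).trans (norm_toH U F u)

theorem denseRange_inclH : DenseRange (inclH U F) :=
  fun z => by
    have := UniformSpace.Completion.denseRange_coe (α := GTensorH U F) z
    rwa [← (toH U F).surjective.range_comp] at this

/-- The bounded linear map `γ ↦ (y ↦ φ (γ ⊗ y))`. -/
def curryH (φ : StrongDual ℂ (CompletedTensorH U F)) : GInf U →L[ℂ] StrongDual ℂ F :=
  LinearMap.mkContinuous₂ (TensorProduct.curry (φ.toLinearMap ∘ₗ inclHₗ U F)) ‖φ‖ fun γ y => by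
    refine (φ.le_opNorm _).trans ?_
    rw [mul_assoc]
    gcongr
    exact (norm_inclH U F _).trans_le (normH_tmul_le U F γ y)

theorem norm_curryH_le (φ : StrongDual ℂ (CompletedTensorH U F)) : ‖curryH U F φ‖ ≤ ‖φ‖ :=
  LinearMap.mkContinuous₂_norm_le _ (norm_nonneg _) _

/-- A functional on the completed tensor product is determined on the tensors `δ(x) ⊗ y`. -/
theorem dual_ext {φ ψ : StrongDual ℂ (CompletedTensorH U F)}
    (h : ∀ (x : U) (y : F), φ (inclH U F (delta U x ⊗ₜ y)) = ψ (inclH U F (delta U x ⊗ₜ y))) :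
    φ = ψ := by
  have hc : curryH U F φ = curryH U F ψ :=
    GInf.clm_ext U fun x => ContinuousLinearMap.ext fun y => h x y
  have ht : φ.toLinearMap ∘ₗ inclHₗ U F = ψ.toLinearMap ∘ₗ inclHₗ U F :=
    TensorProduct.ext' fun γ y => congr($hc γ y)
  exact DFunLike.coe_injective ((denseRange_inclH U F).equalizer φ.continuous ψ.continuous
    (funext fun u => LinearMap.congr_fun ht u))

/-- The bound `|u(f)| ≤ H(u)‖f‖` lets `u ↦ u(f)` extend by density with norm at most `‖f‖`. -/
theorem exists_dual_extension (f : HInf U (StrongDual ℂ F)) :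
    ∃ φ : StrongDual ℂ (CompletedTensorH U F), ‖φ‖ ≤ ‖f‖ ∧
      ∀ u, φ (inclH U F u) = pairing U F u f := by
  let L : GInf U ⊗[ℂ] F →ₗ[ℂ] ℂ :=
    (ContinuousLinearMap.apply ℂ ℂ f).toLinearMap ∘ₗ (pairing U F)
  have hb : ∀ u, ‖L u‖ ≤ ‖f‖ * ‖inclHₗ U F u‖ := fun u => by
    rw [inclHₗ_apply, norm_inclH, normH_eq_norm_pairing, mul_comm]
    exact (pairing U F u).le_opNorm f
  exact ⟨L.extendOfNorm (inclHₗ U F),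
    LinearMap.opNorm_extendOfNorm_le (denseRange_inclH U F) (norm_nonneg f) hb,
    LinearMap.extendOfNorm_eq (denseRange_inclH U F) ⟨_, hb⟩⟩

/-- The mapping `x ↦ (y ↦ φ (δ(x) ⊗ y))` associated with a functional `φ`. -/
def ofDual : StrongDual ℂ (CompletedTensorH U F) →ₗ[ℂ] HInf U (StrongDual ℂ F) where
  toFun φ := HInf.ofClm U (curryH U F φ)
  map_add' _ _ := rfl
  map_smul' _ _ := rfl

theorem ofDual_apply (φ : StrongDual ℂ (CompletedTensorH U F)) (x : U) (y : F) :
    ofDual U F φ x y = φ (inclH U F (delta U x ⊗ₜ y)) := rfl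

theorem ofDual_eq_iff {φ : StrongDual ℂ (CompletedTensorH U F)} {f : HInf U (StrongDual ℂ F)} :
    ofDual U F φ = f ↔ ∀ u, φ (inclH U F u) = pairing U F u f := by
  obtain ⟨ψ, -, hψ⟩ := exists_dual_extension U F f
  constructor
  · rintro rfl
    have : φ = ψ := dual_ext U F fun x y => by
      rw [hψ, pairing_delta_tmul, ofDual_apply]
    rwa [this] at hψ ⊢
  · exact fun h => HInf.ext fun x => ContinuousLinearMap.ext fun y => h _

/-- `ofDual` as an isometry. -/
def ofDualₗᵢ : StrongDual ℂ (CompletedTensorH U F) →ₗᵢ[ℂ] HInf U (StrongDual ℂ F) where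
  toLinearMap := ofDual U F
  norm_map' φ := by
    -- For the reverse inequality, `φ` coincides with the extension built from its own holomorphic
    -- map, since both agree on `δ(x) ⊗ y`.
    refine le_antisymm ((HInf.norm_ofClm_le U _).trans (norm_curryH_le U F φ)) ?_
    obtain ⟨ψ, hle, hψ⟩ := exists_dual_extension U F (ofDual U F φ)
    have : φ = ψ := dual_ext U F fun x y => by
      rw [hψ, pairing_delta_tmul, ofDual_apply]
    exact this ▸ hle

theorem surjective_ofDualₗᵢ : Function.Surjective (ofDualₗᵢ U F) := fun f => by
  obtain ⟨ψ, -, hψ⟩ := exists_dual_extension U F f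
  exact ⟨ψ, (ofDual_eq_iff U F).2 hψ⟩

/-- The isometric isomorphism of `HInf U F*` onto the dual of the completed tensor product. -/
def dualEquiv : HInf U (StrongDual ℂ F) ≃ₗᵢ[ℂ] StrongDual ℂ (CompletedTensorH U F) :=
  (LinearIsometryEquiv.ofSurjective (ofDualₗᵢ U F) (surjective_ofDualₗᵢ U F)).symm

theorem dualEquiv_inclH (f : HInf U (StrongDual ℂ F)) (u : GInf U ⊗[ℂ] F) :
    dualEquiv U F f (inclH U F u) = pairing U F u f :=
  (ofDual_eq_iff U F).1 ((dualEquiv U F).symm_apply_apply f) u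

end Duality

end HolDual

end

theorem mainTheorem2 {E F : Type*} [NormedAddCommGroup E] [NormedSpace ℂ E] [CompleteSpace E]
    [NormedAddCommGroup F] [NormedSpace ℂ F] [CompleteSpace F]
    (U : TopologicalSpace.Opens E) :
    Function.Injective (HolDual.pairing U F) ∧
    (∀ u : HolDual.GInf U ⊗[ℂ] F,
      HolDual.normH U F u = HolDual.projNorm u ∧
      HolDual.normH U F u = HolDual.chevetSaphar 1 u) ∧
    (∀ u : HolDual.Delta U ⊗[ℂ] F,
      HolDual.normH U F (HolDual.deltaIncl U F u) = HolDual.projNorm u ∧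
      HolDual.normH U F (HolDual.deltaIncl U F u) = HolDual.chevetSaphar 1 u) ∧
    ∃ Λ : HolDual.HInf U (StrongDual ℂ F) ≃ₗᵢ[ℂ]
        StrongDual ℂ (HolDual.CompletedTensorH U F),
      (∀ (f : HolDual.HInf U (StrongDual ℂ F)) (n : ℕ) (c : Fin n → ℂ) (x : Fin n → U)
          (y : Fin n → F),
        Λ f (HolDual.inclH U F (∑ i, c i • (HolDual.delta U (x i) ⊗ₜ[ℂ] y i))) =
          ∑ i, c i * f (x i) (y i)) ∧
      (∀ (φ : StrongDual ℂ (HolDual.CompletedTensorH U F)) (x : U) (y : F),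
        Λ.symm φ x y = φ (HolDual.inclH U F (HolDual.delta U x ⊗ₜ[ℂ] y))) ∧
      (∀ (f : HolDual.HInf U (StrongDual ℂ F))
          (ψ : StrongDual ℂ (HolDual.CompletedTensorH U F)),
        (∀ (x : U) (y : F),
          ψ (HolDual.inclH U F (HolDual.delta U x ⊗ₜ[ℂ] y)) = f x y) → ψ = Λ f) := by
  refine ⟨HolDual.pairing_injective U F, fun u => ?_, fun u => ?_, HolDual.dualEquiv U F, ?_, ?_, ?_⟩
  · rw [HolDual.chevetSaphar_one_eq_projNorm, and_self]
    exact HolDual.normH_eq_projNorm U F u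
  · rw [HolDual.chevetSaphar_one_eq_projNorm, and_self]
    exact HolDual.normH_deltaIncl_eq_projNorm U F u
  · intro f n c x y
    rw [HolDual.dualEquiv_inclH, map_sum, sum_apply]
    simp only [map_smul, smul_apply, HolDual.pairing_delta_tmul, smul_eq_mul]
  · exact fun φ x y => HolDual.ofDual_apply U F φ x y
  · intro f ψ h
    refine HolDual.dual_ext U F fun x y => ?_
    rw [h, HolDual.dualEquiv_inclH, HolDual.pairing_delta_tmul]
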